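/- Let $T(r,f)$ denote the Nevanlinna characteristic of a meromorphic function $f$ on $\mathbb{C}$. A set $E$ of radii has finite logarithmic measure if $\int_{E\cap[1,\infty)}dr/r<\infty$, and $\varphi(r)=S(r,f)$ means that $\varphi(r)=o(T(r,f))$ as $r\to\infty$ outside some set of finite logarithmic measure. For a meromorphic function $g\not\equiv 0$ on $\mathbb{C}$ let $\overline n_{\mathrm{odd}}(r,g)$ be the number of poles of $g$ of odd multiplicity in $|z|<r$, each counted once, let $\overline n_{\mathrm{odd}}(0,g)$ be $1$ if the origin is such a pole and $0$ otherwise, and put $$\overline N_{\mathrm{odd}}(r,g)=\int_0^r\frac{\overline n_{\mathrm{odd}}(t,g)-\overline n_{\mathrm{odd}}(0,g)}{t}\,dt+\overline n_{\mathrm{odd}}(0,g)\log r,\qquad \overline N_{\mathrm{O}}(r,g)=\overline N_{\mathrm{odd}}(r,g)+\overline N_{\mathrm{odd}}(r,1/g).$$ **Theorem.** Let $A$ and $B$ be non-constant meromorphic functions on $\mathbb{C}$, and consider the difference equation $$(\Delta f(z))^2=A(z)\bigl(f(z)f(z+1)-B(z)\bigr),\qquad \Delta f(z)=f(z+1)-f(z).\tag{1}$$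 Let $f_1\not\equiv f_2$ be two admissible solutions of (1), that is, each $f=f_j$ is a transcendental (i.e. non-rational) meromorphic function on $\mathbb{C}$ that satisfies (1), with $T(r,A)=S(r,f)$ and $T(r,B)=S(r,f)$. Put $G(f)=(A+4)f^2-4B$. Then either there is a set $E$ of finite logarithmic measure such that $$T(r,f_1)=T(r,f_2)(1+o(1))\qquad\text{as } r\to\infty,\ r\notin E,$$ or $$\overline N_{\mathrm{O}}(r,G(f_1))=\overline N_{\mathrm{O}}(r,G(f_2))\qquad\text{for all } r>0,$$ where "or" is inclusive. -/

import Mathlib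

open Filter MeasureTheory Asymptotics
open scoped Polynomial Topology

namespace DifferenceNevanlinna

noncomputable section

/-- The Nevanlinna characteristic `T(r, f)` of a meromorphic function on the plane. -/
abbrev T (f : ℂ → ℂ) : ℝ → ℝ := ValueDistribution.characteristic f ⊤

/-- `f` is constant as a meromorphic function, i.e. up to its (arbitrary) values on a closed
discrete set. -/
def IsConstantMeromorphic (f : ℂ → ℂ) : Prop :=
  ∃ c : ℂ, f =ᶠ[codiscrete ℂ] fun _ ↦ c

/-- A transcendental meromorphic function: one that is not a rational function. -/
def IsTranscendentalMeromorphic (f : ℂ → ℂ) : Prop :=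
  Meromorphic f ∧
    ¬ ∃ p q : ℂ[X], q ≠ 0 ∧ f =ᶠ[codiscrete ℂ] fun z ↦ p.eval z / q.eval z

/-- A set of radii of finite logarithmic measure: `∫_{E ∩ [1, ∞)} dr / r < ∞`. -/
def FiniteLogMeasure (E : Set ℝ) : Prop :=
  MeasurableSet E ∧ ∫⁻ r in E ∩ Set.Ici 1, ENNReal.ofReal (1 / r) < ⊤

/-- The filter describing `r → ∞`, `r ∉ E`. -/
def atTopOutside (E : Set ℝ) : Filter ℝ := atTop ⊓ 𝓟 Eᶜ

/-- `φ(r) = S(r, f)`: `φ(r) = o(T(r, f))` as `r → ∞` outside some exceptional set of finite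
logarithmic measure. -/
def IsS (φ : ℝ → ℝ) (f : ℂ → ℂ) : Prop :=
  ∃ E : Set ℝ, FiniteLogMeasure E ∧ φ =o[atTopOutside E] T f

/-- `T(r, f₁) = T(r, f₂) (1 + o(1))` as `r → ∞`, `r ∉ E`, for some set `E` of finite logarithmic
measure. -/
def SameGrowth (f₁ f₂ : ℂ → ℂ) : Prop :=
  ∃ E : Set ℝ, FiniteLogMeasure E ∧ T f₁ ~[atTopOutside E] T f₂

/-- `f` solves `(Δ f(z))² = A(z) (f(z) f(z+1) - B(z))`, where `Δ f(z) = f(z+1) - f(z)`, as an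
identity between meromorphic functions. -/
def SolvesEquation (A B f : ℂ → ℂ) : Prop :=
  (fun z ↦ (f (z + 1) - f z) ^ 2) =ᶠ[codiscrete ℂ] fun z ↦ A z * (f z * f (z + 1) - B z)

/-- An admissible solution: a transcendental meromorphic solution with `T(r, A) = S(r, f)` and
`T(r, B) = S(r, f)`. -/
structure IsAdmissibleSolution (A B f : ℂ → ℂ) : Prop where
  transcendental : IsTranscendentalMeromorphic f
  solves : SolvesEquation A B f
  small_A : IsS (T A) f
  small_B : IsS (T B) f

/-- `G(f) = (A + 4) f² - 4 B`. -/
def G (A B f : ℂ → ℂ) : ℂ → ℂ := fun z ↦ (A z + 4) * f z ^ 2 - 4 * B z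

open Classical in
/-- The divisor having coefficient `1` at every pole of `f` of odd multiplicity and coefficient
`0` at all other points. -/
def oddPoleDivisor (f : ℂ → ℂ) : Function.locallyFinsupp ℂ ℤ where
  toFun z :=
    if MeromorphicOn.divisor f Set.univ z < 0 ∧ Odd (MeromorphicOn.divisor f Set.univ z)
    then 1 else 0
  supportWithinDomain' := by simp
  supportLocallyFiniteWithinDomain' z hz := by
    obtain ⟨t, ht, hfin⟩ :=
      (MeromorphicOn.divisor f Set.univ).supportLocallyFiniteWithinDomain' z hz
    refine ⟨t, ht, hfin.subset ?_⟩
    rintro w ⟨hwt, hw⟩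
    refine ⟨hwt, fun h ↦ hw ?_⟩
    have h0 : MeromorphicOn.divisor f Set.univ w = 0 := h
    simp [h0]

/-- The integrated counting function of the odd-multiplicity poles of `f`, each counted once:
`∑_{0 < |z| < r} log (r / |z|) + n(0) log r`, the sum being over the odd-multiplicity poles and
`n(0)` being `1` or `0` according to whether the origin is one of them. For `r > 0` this is
`∫₀ʳ (n(t) - n(0)) / t dt + n(0) log r` with `n(t)` the number of these poles in `|z| < t`. -/
def NbarOdd (f : ℂ → ℂ) : ℝ → ℝ := (oddPoleDivisor f).logCounting

/-- The reduced counting function of the zeros and poles of odd multiplicity: the sum of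
`NbarOdd` for `f` and for `1 / f`. -/
def NbarO (f : ℂ → ℂ) (r : ℝ) : ℝ := NbarOdd f r + NbarOdd f⁻¹ r

end

end DifferenceNevanlinna

namespace DifferenceNevanlinna

open ValueDistribution

/-! The second alternative always holds. Read as a quadratic in `f(z+1)`, the equation has
discriminant `A · G(f)`, so this product is the square of a meromorphic function and its order is
even at every point. Hence `G(f)` has odd order exactly where `A` does, a set independent of the
solution (`IsAdmissibleSolution.odd_divisor_G_iff`), and `NbarO` sees only that set (`NbarO_congr`).
Comparing orders requires `G(f) ≢ 0`. Otherwise `f² = 4B/(A+4)` gives `2T(r,f) ≤ T(r,A) + T(r,B) +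
O(1)`, which contradicts admissibility because `T(r,f) → ∞`. -/

theorem eventuallyEq_codiscrete_iff {f g : ℂ → ℂ} :
    f =ᶠ[codiscrete ℂ] g ↔ ∀ z, f =ᶠ[𝓝[≠] z] g := by
  simp only [EventuallyEq, Filter.Eventually, mem_codiscrete, disjoint_principal_right, compl_compl]

theorem meromorphicOrderAt_ne_top {f : ℂ → ℂ} (hf : Meromorphic f)
    (h : ¬ f =ᶠ[codiscrete ℂ] fun _ ↦ 0) (z : ℂ) : meromorphicOrderAt f z ≠ ⊤ := by
  revert z
  rw [← hf.exists_meromorphicOrderAt_ne_top_iff_forall]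
  by_contra! H
  exact h (eventuallyEq_codiscrete_iff.2 fun z ↦ meromorphicOrderAt_eq_top_iff.1 (H z))

theorem eventually_ne_zero_codiscrete {f : ℂ → ℂ} (hf : Meromorphic f)
    (h : ¬ f =ᶠ[codiscrete ℂ] fun _ ↦ 0) : ∀ᶠ z in codiscrete ℂ, f z ≠ 0 := by
  simp only [Filter.Eventually, mem_codiscrete, disjoint_principal_right, compl_compl]
  exact fun z ↦ (meromorphicOrderAt_ne_top_iff_eventually_ne_zero (hf z)).1
    (meromorphicOrderAt_ne_top hf h z)

/-! ### Growth of the characteristic of a non-constant function -/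

/-- A meromorphic function with bounded characteristic is constant: by the First Main Theorem it
takes no value at all, unless it is that value identically. -/
theorem isConstantMeromorphic_of_isBigO_one {f : ℂ → ℂ} (hf : Meromorphic f)
    (hT : T f =O[atTop] (1 : ℝ → ℝ)) : IsConstantMeromorphic f := by
  -- Analyticity at `z₀` makes `f z₀` a genuine value, so that `f - f z₀` has positive order there.
  obtain ⟨z₀, hz₀⟩ := (hf 0).eventually_analyticAt.exists
  set g : ℂ → ℂ := fun z ↦ f z - f z₀ with hg
  have hgm : Meromorphic g := fun z ↦ (hf z).sub (MeromorphicAt.const _ z)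
  refine ⟨f z₀, ?_⟩
  by_contra hne
  have hg0 : ¬ g =ᶠ[codiscrete ℂ] fun _ ↦ 0 := fun h ↦ hne <| by
    filter_upwards [h] with z hz using sub_eq_zero.1 hz
  have h₁ : T g =O[atTop] (1 : ℝ → ℝ) := by
    simpa using hT.sub (isBigO_characteristic_sub_characteristic_shift (a₀ := f z₀) hf)
  have h₂ : T g⁻¹ =O[atTop] (1 : ℝ → ℝ) := by
    simpa using h₁.sub (isBigO_characteristic_sub_characteristic_inv hgm)
  have h₃ : logCounting g⁻¹ ⊤ =O[atTop] (1 : ℝ → ℝ) := by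
    refine IsBigO.trans (IsBigO.of_bound 1 ?_) h₂
    filter_upwards [eventually_ge_atTop 1] with r hr
    rw [one_mul, Real.norm_of_nonneg (logCounting_nonneg hr),
      Real.norm_of_nonneg (characteristic_nonneg hr)]
    exact le_add_of_nonneg_left (proximity_nonneg r)
  -- A bounded counting function means that `g⁻¹` has no poles, so `g` has no zeros.
  rw [logCounting_top,
    ← Function.locallyFinsuppWithin.zero_iff_logCounting_bounded (negPart_nonneg _),
    negPart_eq_zero, MeromorphicOn.divisor_inv] at h₃
  have h₄ := h₃ z₀
  simp only [Function.locallyFinsuppWithin.coe_zero, Pi.zero_apply,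
    Function.locallyFinsuppWithin.coe_neg, Pi.neg_apply] at h₄
  rw [MeromorphicOn.divisor_apply hgm.meromorphicOn (Set.mem_univ _)] at h₄
  have hga : AnalyticAt ℂ g z₀ := hz₀.sub analyticAt_const
  have hpos : 0 < meromorphicOrderAt g z₀ := by
    refine lt_of_le_of_ne hga.meromorphicOrderAt_nonneg fun h ↦ ?_
    rw [hga.meromorphicOrderAt_eq, eq_comm] at h
    have := (hga.analyticOrderAt_eq_zero.1 (by simpa using h))
    simp [hg] at this
  have htop := meromorphicOrderAt_ne_top hgm hg0 z₀
  lift meromorphicOrderAt g z₀ to ℤ using htop with n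
  simp at h₄ hpos
  lia

/-- By monotonicity, values below `C` at arbitrarily large radii bound the characteristic everywhere
on `[1, ∞)`. -/
theorem tendsto_characteristic_atTop {f : ℂ → ℂ} (hf : Meromorphic f)
    (hc : ¬ IsConstantMeromorphic f) : Tendsto (T f) atTop atTop := by
  rw [tendsto_atTop]
  by_contra! H
  obtain ⟨C, hC⟩ := H
  refine hc (isConstantMeromorphic_of_isBigO_one hf (IsBigO.of_bound C ?_))
  filter_upwards [eventually_ge_atTop 1] with r hr
  obtain ⟨s, hs, hrs⟩ := (hC.and_eventually (eventually_ge_atTop r)).exists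
  have hm := characteristic_monotoneOn hf (Set.mem_Ioi.2 (by linarith : 0 < r))
    (Set.mem_Ioi.2 (by linarith : 0 < s)) hrs
  rw [Real.norm_of_nonneg (characteristic_nonneg hr)]
  simp only [Pi.one_apply, norm_one, mul_one]
  exact hm.trans hs.le

theorem IsTranscendentalMeromorphic.not_isConstantMeromorphic {f : ℂ → ℂ}
    (hf : IsTranscendentalMeromorphic f) : ¬ IsConstantMeromorphic f := by
  rintro ⟨c, hc⟩
  exact hf.2 ⟨Polynomial.C c, 1, one_ne_zero, by simpa using hc⟩

/-! ### Exceptional sets -/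

theorem FiniteLogMeasure.union {E F : Set ℝ} (hE : FiniteLogMeasure E) (hF : FiniteLogMeasure F) :
    FiniteLogMeasure (E ∪ F) := by
  refine ⟨hE.1.union hF.1, ?_⟩
  rw [Set.union_inter_distrib_right]
  exact (lintegral_union_le _ _ _).trans_lt (ENNReal.add_lt_top.2 ⟨hE.2, hF.2⟩)

theorem lintegral_Ici_one_div_eq_top {a : ℝ} (ha : 0 < a) :
    ∫⁻ r in Set.Ici a, ENNReal.ofReal (1 / r) = ⊤ := by
  by_contra h
  refine not_integrableOn_Ioi_inv (a := a) ?_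
  refine IntegrableOn.mono_set (t := Set.Ici a) ⟨by fun_prop, ?_⟩ Set.Ioi_subset_Ici_self
  rw [hasFiniteIntegral_iff_ofReal]
  · simpa using lt_top_iff_ne_top.2 h
  · filter_upwards [ae_restrict_mem measurableSet_Ici] with r hr
    exact inv_nonneg.2 (ha.le.trans hr)

/-- Since `∫ dr/r` diverges, radii outside `E` are unbounded; estimates off `E` can thus be
evaluated at an actual radius. -/
theorem FiniteLogMeasure.neBot {E : Set ℝ} (hE : FiniteLogMeasure E) :
    (atTopOutside E).NeBot := by
  rw [atTopOutside, ← frequently_mem_iff_neBot]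
  intro h
  obtain ⟨a, ha⟩ := eventually_atTop.1 h
  have hsub : Set.Ici (max a 1) ⊆ E ∩ Set.Ici 1 := fun r hr ↦
    ⟨not_not.1 (ha r ((le_max_left _ _).trans hr)), (le_max_right a 1).trans hr⟩
  have := (lintegral_mono_set hsub).trans_lt hE.2
  rw [lintegral_Ici_one_div_eq_top (by positivity)] at this
  exact lt_irrefl _ this

theorem atTopOutside_anti {E F : Set ℝ} (h : E ⊆ F) : atTopOutside F ≤ atTopOutside E :=
  inf_le_inf_left _ (principal_mono.2 (Set.compl_subset_compl.2 h))

/-! ### Non-degeneracy of the discriminant -/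

theorem characteristic_const_top (c : ℂ) (r : ℝ) : T (fun _ ↦ c) r = Real.posLog ‖c‖ := by
  simp [T, characteristic, proximity, Real.circleAverage_const]

/-- If `G(f) ≡ 0` then `f² = 4 B / (A + 4)`, whose characteristic is bounded in terms of those of
`A` and `B`. -/
theorem two_mul_characteristic_le_of_G_eq_zero {A B f : ℂ → ℂ} (hA : Meromorphic A)
    (hB : Meromorphic B) (hA' : ¬ IsConstantMeromorphic A) (hB' : ¬ IsConstantMeromorphic B)
    (hf : Meromorphic f) (hG : G A B f =ᶠ[codiscrete ℂ] fun _ ↦ 0) :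
    ∃ C, ∀ r, 1 ≤ r → 2 * T f r ≤ T A r + T B r + C := by
  set D : ℂ → ℂ := fun z ↦ A z - (-4) with hD
  have hDm : Meromorphic D := fun z ↦ (hA z).sub (MeromorphicAt.const _ z)
  have hD0 : ¬ D =ᶠ[codiscrete ℂ] fun _ ↦ 0 := fun h ↦ hA' ⟨-4, by
    filter_upwards [h] with z hz using sub_eq_zero.1 hz⟩
  have hB0 : ¬ B =ᶠ[codiscrete ℂ] fun _ ↦ 0 := fun h ↦ hB' ⟨0, h⟩
  have h4m : Meromorphic (fun _ : ℂ ↦ (4 : ℂ)) := fun z ↦ MeromorphicAt.const _ z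
  have h4 : ∀ z, meromorphicOrderAt (fun _ : ℂ ↦ (4 : ℂ)) z ≠ ⊤ := fun z ↦ by
    simp [meromorphicOrderAt_const]
  have hBt := meromorphicOrderAt_ne_top hB hB0
  have hDt := meromorphicOrderAt_ne_top hDm hD0
  have hEq : f ^ 2 =ᶠ[codiscrete ℂ] ((fun _ ↦ 4) * B) * D⁻¹ := by
    filter_upwards [hG, eventually_ne_zero_codiscrete hDm hD0] with z hz hDz
    simp only [Pi.pow_apply, Pi.mul_apply, Pi.inv_apply]
    rw [eq_mul_inv_iff_mul_eq₀ hDz]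
    simp only [G] at hz
    simp only [hD]
    linear_combination hz
  -- The constants come, in order, from the factor `4`, the shift from `A` to `A + 4`, and the First
  -- Main Theorem for `D⁻¹`.
  refine ⟨Real.posLog ‖(4 : ℂ)‖ + (Real.posLog ‖(-4 : ℂ)‖ + Real.log 2) +
    max |Real.log ‖D 0‖| |Real.log ‖meromorphicTrailingCoeffAt D 0‖|, fun r hr ↦ ?_⟩
  have e₁ : 2 * T f r = T (((fun _ ↦ 4) * B) * D⁻¹) r := by
    rw [T, T, ← characteristic_congr_codiscrete hEq (by linarith), characteristic_pow_top hf]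
    simp
  have e₂ : T (((fun _ ↦ 4) * B) * D⁻¹) r ≤ T ((fun _ ↦ 4) * B) r + T D⁻¹ r :=
    characteristic_mul_top_le hr (h4m.mul hB)
      (fun z ↦ by
        rw [meromorphicOrderAt_mul (h4m z) (hB z)]
        exact WithTop.add_ne_top.2 ⟨h4 z, hBt z⟩) hDm.inv
      (fun z ↦ by
        rw [meromorphicOrderAt_inv]
        simpa using hDt z)
  have e₃ : T ((fun _ ↦ 4) * B) r ≤ T (fun _ ↦ 4) r + T B r :=
    characteristic_mul_top_le hr h4m h4 hB hBt
  have e₄ := abs_le.1 (characteristic_sub_characteristic_inv_le (R := r) hDm)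
  have e₅ := abs_le.1 (abs_characteristic_sub_characteristic_shift_le (a₀ := -4) (r := r) hA)
  rw [characteristic_const_top] at e₃
  have e₆ := e₄.1
  have e₇ := e₅.1
  simp only [T] at *
  linarith

theorem IsAdmissibleSolution.G_ne_zero {A B f : ℂ → ℂ} (hA : Meromorphic A)
    (hB : Meromorphic B) (hA' : ¬ IsConstantMeromorphic A) (hB' : ¬ IsConstantMeromorphic B)
    (hf : IsAdmissibleSolution A B f) : ¬ G A B f =ᶠ[codiscrete ℂ] fun _ ↦ 0 := by
  intro hG
  have hfm := hf.transcendental.1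
  obtain ⟨C, hC⟩ := two_mul_characteristic_le_of_G_eq_zero hA hB hA' hB' hfm hG
  obtain ⟨E, hE, hAE⟩ := hf.small_A
  obtain ⟨F, hF, hBF⟩ := hf.small_B
  have hne : (atTopOutside (E ∪ F)).NeBot := (hE.union hF).neBot
  have hle : atTopOutside (E ∪ F) ≤ atTop := inf_le_left
  -- With `1/2` for both `A` and `B`, the bound reads `2T ≤ T + C`, against `T > C`.
  have h₁ := (hAE.mono (atTopOutside_anti (F := E ∪ F) Set.subset_union_left)).bound
    (c := 1 / 2) (by norm_num)
  have h₂ := (hBF.mono (atTopOutside_anti (F := E ∪ F) Set.subset_union_right)).bound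
    (c := 1 / 2) (by norm_num)
  have h₃ := hle ((tendsto_characteristic_atTop hfm
    hf.transcendental.not_isConstantMeromorphic).eventually_gt_atTop C)
  obtain ⟨r, ⟨⟨h₁, h₂⟩, h₃⟩, h₄⟩ := (((h₁.and h₂).and h₃).and (hle (eventually_ge_atTop 1))).exists
  have hr := hC r h₄
  have hT : 0 ≤ T f r := characteristic_nonneg h₄
  rw [Real.norm_of_nonneg hT] at h₁ h₂
  have := (Real.le_norm_self _).trans h₁
  have := (Real.le_norm_self _).trans h₂
  linarith

/-! ### Parity of the orders of the discriminant -/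

/-- The equation is quadratic in `f(z + 1)` with discriminant `A · G(f)`, which is therefore a
square. -/
theorem SolvesEquation.mul_G_eq_sq {A B f : ℂ → ℂ} (h : SolvesEquation A B f) :
    A * G A B f =ᶠ[codiscrete ℂ] (fun z ↦ 2 * f (z + 1) - (A z + 2) * f z) ^ 2 := by
  filter_upwards [h] with z hz
  simp only [Pi.mul_apply, Pi.pow_apply, G]
  linear_combination (-4) * hz

theorem meromorphic_G {A B f : ℂ → ℂ} (hA : Meromorphic A) (hB : Meromorphic B)
    (hf : Meromorphic f) : Meromorphic (G A B f) := by
  unfold G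
  fun_prop

theorem IsAdmissibleSolution.odd_divisor_G_iff {A B f : ℂ → ℂ} (hA : Meromorphic A)
    (hB : Meromorphic B) (hA' : ¬ IsConstantMeromorphic A) (hB' : ¬ IsConstantMeromorphic B)
    (hf : IsAdmissibleSolution A B f) (z : ℂ) :
    Odd (MeromorphicOn.divisor (G A B f) Set.univ z) ↔
      Odd (MeromorphicOn.divisor A Set.univ z) := by
  have hfm := hf.transcendental.1
  have hGm := meromorphic_G hA hB hfm
  have hAt := meromorphicOrderAt_ne_top hA (fun h ↦ hA' ⟨0, h⟩) z
  have hGt := meromorphicOrderAt_ne_top hGm (hf.G_ne_zero hA hB hA' hB') z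
  have hs : Meromorphic fun z ↦ f (z + 1) := fun z ↦
    meromorphicAt_fun_comp_add_const_iff_meromorphicAt.2 (hfm (z + 1))
  have hh : MeromorphicAt (fun z ↦ 2 * f (z + 1) - (A z + 2) * f z) z := by
    have := hs z
    have := hA z
    have := hfm z
    fun_prop
  have key := meromorphicOrderAt_congr (eventuallyEq_codiscrete_iff.1 hf.solves.mul_G_eq_sq z)
  rw [meromorphicOrderAt_mul (hA z) (hGm z), meromorphicOrderAt_pow hh] at key
  rw [MeromorphicOn.divisor_apply hGm.meromorphicOn (Set.mem_univ _),
    MeromorphicOn.divisor_apply hA.meromorphicOn (Set.mem_univ _)]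
  lift meromorphicOrderAt A z to ℤ using hAt with a
  lift meromorphicOrderAt (G A B f) z to ℤ using hGt with g
  -- The square root cannot vanish identically near `z`, as `A` and `G(f)` have finite order there.
  cases hn : meromorphicOrderAt (fun z ↦ 2 * f (z + 1) - (A z + 2) * f z) z with
  | top =>
    rw [hn] at key
    exact absurd key (by simp [← WithTop.coe_add])
  | coe n =>
    rw [hn] at key
    have key' : a + g = 2 * n := WithTop.coe_injective (by simpa using key)
    simp only [WithTop.untop₀_coe]
    grind

/-- An odd order is nonzero, so such a point is a pole of exactly one of `g` and `g⁻¹`. -/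
theorem oddPoleDivisor_add_oddPoleDivisor_inv_apply (g : ℂ → ℂ) (z : ℂ) [Decidable
    (Odd (MeromorphicOn.divisor g Set.univ z))] :
    (oddPoleDivisor g + oddPoleDivisor g⁻¹) z =
      if Odd (MeromorphicOn.divisor g Set.univ z) then 1 else 0 := by
  have h₁ : ∀ h : ℂ → ℂ, oddPoleDivisor h z = if MeromorphicOn.divisor h Set.univ z < 0 ∧
      Odd (MeromorphicOn.divisor h Set.univ z) then 1 else 0 := fun h ↦ by
    simp only [oddPoleDivisor, Function.locallyFinsuppWithin.coe_mk]
  simp only [Function.locallyFinsuppWithin.coe_add, Pi.add_apply, h₁, MeromorphicOn.divisor_inv,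
    Function.locallyFinsuppWithin.coe_neg, Pi.neg_apply, odd_neg]
  split_ifs <;> grind

/-- `NbarO g` depends only on the set of points where `g` has odd order. -/
theorem NbarO_congr {g h : ℂ → ℂ} (H : ∀ z, Odd (MeromorphicOn.divisor g Set.univ z) ↔
    Odd (MeromorphicOn.divisor h Set.univ z)) : NbarO g = NbarO h := by
  classical
  have : oddPoleDivisor g + oddPoleDivisor g⁻¹ = oddPoleDivisor h + oddPoleDivisor h⁻¹ := by
    ext z
    simp only [oddPoleDivisor_add_oddPoleDivisor_inv_apply, H]
  have := congrArg Function.locallyFinsuppWithin.logCounting this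
  rw [map_add, map_add] at this
  exact this

end DifferenceNevanlinna

theorem theorem5p1 (A B f₁ f₂ : ℂ → ℂ)
    (hA : Meromorphic A) (hB : Meromorphic B)
    (hA' : ¬ DifferenceNevanlinna.IsConstantMeromorphic A)
    (hB' : ¬ DifferenceNevanlinna.IsConstantMeromorphic B)
    (hf₁ : DifferenceNevanlinna.IsAdmissibleSolution A B f₁)
    (hf₂ : DifferenceNevanlinna.IsAdmissibleSolution A B f₂)
    (hne : ¬ f₁ =ᶠ[codiscrete ℂ] f₂) :
    DifferenceNevanlinna.SameGrowth f₁ f₂ ∨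
      ∀ r : ℝ, 0 < r →
        DifferenceNevanlinna.NbarO (DifferenceNevanlinna.G A B f₁) r =
          DifferenceNevanlinna.NbarO (DifferenceNevanlinna.G A B f₂) r := by
  refine Or.inr fun r _ ↦ congrFun (DifferenceNevanlinna.NbarO_congr fun z ↦ ?_) r
  rw [hf₁.odd_divisor_G_iff hA hB hA' hB', hf₂.odd_divisor_G_iff hA hB hA' hB']
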